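/- Let $B=[b_1,\dots,b_n]$ be a basis of a lattice $L$, with Gram–Schmidt vectors $\tilde b_i=\pi_i(b_i)$, where $\pi_i$ is the orthogonal projection onto $\{b_1,\dots,b_{i-1}\}^\perp$, let $\mu_{ij}=\langle b_i,\tilde b_j\rangle/\langle\tilde b_j,\tilde b_j\rangle$, and let $\eta(B)=\max_{i\le j}\|\tilde b_i\|/\|\tilde b_j\|$. Write $\lambda_1(L)$ for the length of a shortest nonzero vector of $L$. The dual lattice is $L^*=\{x\in\operatorname{span}_{\mathbb R}L:\langle x,y\rangle\in\mathbb Z\ \forall y\in L\}$, and the dual basis $[b_1^*,\dots,b_n^*]$ of $B$ is given by $b_i^*\in\operatorname{span}_{\mathbb R}L$ and $\langle b_i^*,b_j\rangle=\delta_{ij}$. The basis $B$ is *HKZ-reduced* if (1) $|\mu_{ij}|\le 1/2$ for all $j<i$; (2) $\|b_1\|=\lambda_1(L)$; and (3) if $n>1$, then $[\pi_2(b_2),\dots,\pi_2(b_n)]$ is an HKZ-reduced basis of $\pi_2(L)$. It is *$\varepsilon$-DSVP-reduced* if $\|b_n^*\|\le(1+\varepsilon)\lambda_1(L^*)$. For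 $\varepsilon>0$ and an integer $k\ge 2$ dividing $n$, it is *$(\varepsilon,k)$-slide-reduced* if (1) $|\mu_{ij}|\le 1/2$ for all $j<i$; (2) $[\pi_{ik+1}(b_{ik+1}),\dots,\pi_{ik+1}(b_{ik+k})]$ is HKZ-reduced for all $0\le i\le n/k-1$; and (3) $[\pi_{ik+2}(b_{ik+2}),\dots,\pi_{ik+2}(b_{ik+k+1})]$ is $\varepsilon$-DSVP-reduced for all $0\le i\le n/k-2$. **Proposition.** There is an absolute constant $C>0$ such that for every integer $n\ge 1$, every integer $k\ge 2$ dividing $n$, and every $(1/n,k)$-slide-reduced basis $B=[b_1,\dots,b_n]$ of a (full-rank) lattice $L\subset\mathbb Q^n$, $$\eta(B)\le k^{\,C\,(n/k+\log k)}.$$ -/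

import Mathlib

namespace LatticeReduction

noncomputable section

variable {E : Type*} [NormedAddCommGroup E] [InnerProductSpace ℝ E]

/-- The lattice `L(b) = {∑ cᵢ bᵢ : cᵢ ∈ ℤ}` generated by a finite family of vectors. -/
def latticeOf {n : ℕ} (b : Fin n → E) : Submodule ℤ E :=
  Submodule.span ℤ (Set.range b)

/-- `b` is a basis of the lattice `L`: the vectors are linearly independent over `ℝ` and `L` is
the set of their integer combinations. -/
def IsLatticeBasis {n : ℕ} (b : Fin n → E) (L : Submodule ℤ E) : Prop :=
  LinearIndependent ℝ b ∧ latticeOf b = L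

/-- The `i`-th successive minimum of a lattice,
`inf {r > 0 : dim span (L ∩ r B) ≥ i}`, where `r B` is the closed ball of radius `r`. -/
def successiveMinimum (L : Submodule ℤ E) (i : ℕ) : ℝ :=
  sInf {r : ℝ | 0 < r ∧
    i ≤ Module.finrank ℝ (Submodule.span ℝ ((L : Set E) ∩ Metric.closedBall 0 r))}

/-- The dual lattice `{x ∈ span L : ⟨x, y⟩ ∈ ℤ for all y ∈ L}`. A lattice that is not of full
rank is regarded as living in its real span, and so is its dual. -/
def dualLattice (L : Submodule ℤ E) : Submodule ℤ E where
  carrier := {x | x ∈ Submodule.span ℝ (L : Set E) ∧ ∀ y ∈ L, ∃ m : ℤ, inner ℝ x y = (m : ℝ)}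
  zero_mem' := ⟨Submodule.zero_mem _, fun y _ => ⟨0, by simp⟩⟩
  add_mem' := by
    rintro x x' ⟨hx, hxL⟩ ⟨hx', hxL'⟩
    refine ⟨Submodule.add_mem _ hx hx', fun y hy => ?_⟩
    obtain ⟨m, hm⟩ := hxL y hy
    obtain ⟨m', hm'⟩ := hxL' y hy
    exact ⟨m + m', by rw [inner_add_left, hm, hm']; push_cast; rfl⟩
  smul_mem' := by
    rintro c x ⟨hx, hxL⟩
    refine ⟨Submodule.smul_of_tower_mem _ c hx, fun y hy => ?_⟩
    obtain ⟨m, hm⟩ := hxL y hy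
    refine ⟨c * m, ?_⟩
    rw [← Int.cast_smul_eq_zsmul ℝ c x, real_inner_smul_left, hm]
    push_cast
    rfl

/-- `d` is the dual basis of `b`: the family in the real span of `b` that is determined by
`⟨dᵢ, bⱼ⟩ = δᵢⱼ`. It exists and is unique when `b` is linearly independent. For `n` vectors in
`ℝⁿ` it consists of the columns of the inverse transpose of the matrix with columns `b`. -/
def IsDualBasis {n : ℕ} (b d : Fin n → E) : Prop :=
  (∀ i, d i ∈ Submodule.span ℝ (Set.range b)) ∧
    ∀ i j, inner ℝ (d i) (b j) = if i = j then (1 : ℝ) else 0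

/-- The Gram–Schmidt coefficients `μᵢⱼ = ⟨bᵢ, b̃ⱼ⟩ / ⟨b̃ⱼ, b̃ⱼ⟩`. -/
def gsCoeff {n : ℕ} (b : Fin n → E) (i j : Fin n) : ℝ :=
  inner ℝ (b i) (InnerProductSpace.gramSchmidt ℝ b j) /
    inner ℝ (InnerProductSpace.gramSchmidt ℝ b j) (InnerProductSpace.gramSchmidt ℝ b j)

/-- `|μᵢⱼ| ≤ 1/2` for all `j < i`. -/
def IsSizeReduced {n : ℕ} (b : Fin n → E) : Prop :=
  ∀ i j : Fin n, j < i → |gsCoeff b i j| ≤ 1 / 2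

/-- The decay `η(b) = max_{i ≤ j} ‖b̃ᵢ‖ / ‖b̃ⱼ‖` of the Gram–Schmidt vectors of `b`
(the supremum is over a finite set, which is nonempty for `n ≥ 1`). -/
def gsDecay {n : ℕ} (b : Fin n → E) : ℝ :=
  ⨆ p : {p : Fin n × Fin n // p.1 ≤ p.2},
    ‖InnerProductSpace.gramSchmidt ℝ b p.1.1‖ / ‖InnerProductSpace.gramSchmidt ℝ b p.1.2‖

/-- `b` is `ε`-DSVP reduced: the last vector of its dual basis has length at most
`(1 + ε) λ₁(L*)`, where `L*` is the dual of the lattice generated by `b`. -/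
def IsDSVPReduced (ε : ℝ) {n : ℕ} (b : Fin n → E) : Prop :=
  ∃ d : Fin n → E, IsDualBasis b d ∧
    ∀ i : Fin n, (i : ℕ) + 1 = n →
      ‖d i‖ ≤ (1 + ε) * successiveMinimum (dualLattice (latticeOf b)) 1

variable [FiniteDimensional ℝ E]

/-- The orthogonal projection onto the orthogonal complement of the first `s` vectors of `b`
(with vectors numbered from `1` this is `π_{s+1}`). -/
def proj {n : ℕ} (b : Fin n → E) (s : ℕ) : E →L[ℝ] E :=
  (Submodule.span ℝ (b '' {j : Fin n | (j : ℕ) < s}))ᗮ.starProjection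

/-- HKZ-reduced bases, for a linearly independent family `b`: size-reduced, the first vector is
a shortest nonzero vector of the lattice, and the remaining vectors, projected orthogonally to the
first one, are again HKZ reduced. (The empty family is HKZ reduced, so that for a single vector
the last condition is void.) -/
def IsHKZReduced : {n : ℕ} → (Fin n → E) → Prop
  | 0, _ => True
  | _ + 1, b =>
      IsSizeReduced b ∧
      ‖b 0‖ = successiveMinimum (latticeOf b) 1 ∧
      IsHKZReduced (fun i => proj b 1 (b i.succ))

/-- The projected block of the `k` vectors of `b` that follow the first `s` vectors, projected
orthogonally to those first `s` vectors. -/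
def projBlock {n : ℕ} (b : Fin n → E) (s k : ℕ) (h : s + k ≤ n) : Fin k → E :=
  fun l => proj b s (b ⟨s + l, by omega⟩)

/-- `(ε, k)`-slide-reduced bases, for `2 ≤ k ∣ n` and a linearly independent family `b`.
As `k ∣ n`, the bound `i k + k ≤ n` says `i ≤ n / k - 1`, and `i k + 1 + k ≤ n` says
`i ≤ n / k - 2`. -/
structure IsSlideReduced (ε : ℝ) (k : ℕ) {n : ℕ} (b : Fin n → E) : Prop where
  sizeReduced : IsSizeReduced b
  hkz : ∀ (i : ℕ) (h : i * k + k ≤ n), IsHKZReduced (projBlock b (i * k) k h)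
  dsvp : ∀ (i : ℕ) (h : i * k + 1 + k ≤ n), IsDSVPReduced ε (projBlock b (i * k + 1) k h)

end

end LatticeReduction

/-!
The argument runs on the logarithms `X l = log ‖b̃ₗ‖`. The first `m` vectors of a basis span a
sublattice of determinant `∏_{l < m} ‖b̃ₗ‖`, so Minkowski's theorem bounds `log λ₁` by `log m / 2`
plus the mean of `X` over these indices. In an HKZ-reduced block this applies to every projected
tail, and each `X a` is at most about the mean of any stretch that starts at `a`. The Gram–Schmidt
vectors of the reversed dual basis are the inverses `b̃ₗ / ‖b̃ₗ‖²` in reverse order, so the same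
bound on the dual of a DSVP-reduced block shows that the mean of its last entries is at most about
its last entry.

Within a block, comparison with running averages is a discrete Gronwall inequality and costs a
harmonic sum, hence a decay of order `(log k)²`. Combining the two mean inequalities over a whole
block, where all interior terms cancel, the first entries of consecutive blocks differ by
`O(log k)`; telescoping over the `n / k` blocks gives the bound.
-/

namespace LatticeReduction

open InnerProductSpace Submodule

variable {E : Type*} [NormedAddCommGroup E] [InnerProductSpace ℝ E]

section GramSchmidt

theorem mem_orthogonal_span_image_iff {ι : Type*} {b : ι → E} {s : Set ι} {v : E} :
    v ∈ (span ℝ (b '' s))ᗮ ↔ ∀ j ∈ s, inner ℝ v (b j) = 0 := by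
  rw [← span_singleton_le_iff_mem, ← isOrtho_iff_le, isOrtho_span]
  simp

variable {ι : Type*} [LinearOrder ι] [LocallyFiniteOrderBot ι] [WellFoundedLT ι]

theorem gramSchmidt_mem_orthogonal_span_Iio (b : ι → E) (i : ι) :
    gramSchmidt ℝ b i ∈ (span ℝ (b '' Set.Iio i))ᗮ :=
  mem_orthogonal_span_image_iff.2 fun _ hj => gramSchmidt_inv_triangular ℝ b hj

theorem sub_gramSchmidt_mem_span_Iio (b : ι → E) (i : ι) :
    b i - gramSchmidt ℝ b i ∈ span ℝ (b '' Set.Iio i) := by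
  rw [← span_gramSchmidt_Iio ℝ b i, gramSchmidt_def ℝ b i, sub_sub_cancel]
  refine sum_mem fun j hj => span_mono ?_ (starProjection_apply_mem _ _)
  exact Set.singleton_subset_iff.2 ⟨j, Finset.mem_Iio.1 hj, rfl⟩

theorem gramSchmidt_eq_of_mem_orthogonal {b : ι → E} {i : ι} {v : E}
    (hsub : b i - v ∈ span ℝ (b '' Set.Iio i)) (horth : v ∈ (span ℝ (b '' Set.Iio i))ᗮ) :
    gramSchmidt ℝ b i = v := by
  have hmem : gramSchmidt ℝ b i - v ∈ span ℝ (b '' Set.Iio i) := by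
    simpa using sub_mem hsub (sub_gramSchmidt_mem_span_Iio b i)
  have hmem' := sub_mem (gramSchmidt_mem_orthogonal_span_Iio b i) horth
  exact sub_eq_zero.1 (inner_self_eq_zero.1 (inner_right_of_mem_orthogonal hmem hmem'))

theorem inner_gramSchmidt_self (b : ι → E) (i : ι) :
    inner ℝ (gramSchmidt ℝ b i) (b i) = ‖gramSchmidt ℝ b i‖ ^ 2 := by
  have h := inner_left_of_mem_orthogonal (sub_gramSchmidt_mem_span_Iio b i)
    (gramSchmidt_mem_orthogonal_span_Iio b i)
  rw [inner_sub_right, sub_eq_zero] at h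
  rw [h, real_inner_self_eq_norm_sq]

theorem linearIndependent_of_gramSchmidt_ne_zero [Finite ι] {b : ι → E}
    (h : ∀ i, gramSchmidt ℝ b i ≠ 0) : LinearIndependent ℝ b := by
  have := Fintype.ofFinite ι
  have hgs : LinearIndependent ℝ (gramSchmidt ℝ b) :=
    linearIndependent_of_ne_zero_of_inner_eq_zero h fun _ _ => gramSchmidt_orthogonal ℝ b
  rw [linearIndependent_iff_card_eq_finrank_span] at hgs ⊢
  rw [hgs, Set.finrank, span_gramSchmidt, Set.finrank]

theorem det_inner_gramSchmidtNormed [Fintype ι] (b : ι → E) :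
    (Matrix.of fun i j => inner ℝ (gramSchmidtNormed ℝ b i) (b j)).det =
      ∏ i, ‖gramSchmidt ℝ b i‖ := by
  rw [Matrix.det_of_isUpperTriangular]
  · refine Finset.prod_congr rfl fun i _ => ?_
    rw [Matrix.of_apply, gramSchmidtNormed, RCLike.ofReal_real_eq_id, id,
      real_inner_smul_left, inner_gramSchmidt_self, sq, ← mul_assoc, inv_mul_mul_self]
  · intro i j (hij : j < i)
    rw [Matrix.of_apply, gramSchmidtNormed, RCLike.ofReal_real_eq_id, id,
      real_inner_smul_left, gramSchmidt_inv_triangular ℝ b hij, mul_zero]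

/-- The logarithmic profile `l ↦ log ‖b̃ₗ‖` of a family `b`. It is extended by zero to all of `ℕ`,
so that blocks of vectors correspond to shifts of the index. -/
noncomputable def gsLog {n : ℕ} (b : Fin n → E) (l : ℕ) : ℝ :=
  if h : l < n then Real.log ‖gramSchmidt ℝ b ⟨l, h⟩‖ else 0

theorem gsLog_coe {n : ℕ} (b : Fin n → E) (i : Fin n) :
    gsLog b i = Real.log ‖gramSchmidt ℝ b i‖ :=
  dif_pos i.2

theorem gsLog_zero {n : ℕ} (b : Fin (n + 1) → E) : gsLog b 0 = Real.log ‖b 0‖ := by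
  have h : gramSchmidt ℝ b 0 = b 0 := gramSchmidt_bot ℝ b
  rw [← h]
  exact gsLog_coe b 0

theorem sum_range_gsLog {n : ℕ} {b : Fin n → E} (hb : LinearIndependent ℝ b) :
    ∑ l ∈ Finset.range n, gsLog b l = Real.log (∏ i, ‖gramSchmidt ℝ b i‖) := by
  rw [Real.log_prod fun i _ => norm_ne_zero_iff.2 (gramSchmidt_ne_zero i hb),
    ← Fin.sum_univ_eq_sum_range]
  exact Finset.sum_congr rfl fun i _ => gsLog_coe b i

end GramSchmidt

section ProjectedBlocks

variable [FiniteDimensional ℝ E] {n : ℕ}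

theorem proj_apply_eq_zero (b : Fin n → E) {s : ℕ} {j : Fin n} (hj : (j : ℕ) < s) :
    proj b s (b j) = 0 :=
  starProjection_orthogonal_apply_eq_zero (subset_span ⟨j, hj, rfl⟩)

theorem proj_gramSchmidt (b : Fin n → E) {s : ℕ} {i : Fin n} (hi : s ≤ i) :
    proj b s (gramSchmidt ℝ b i) = gramSchmidt ℝ b i :=
  starProjection_eq_self_iff.2 <| mem_orthogonal_span_image_iff.2 fun j (hj : (j : ℕ) < s) =>
    gramSchmidt_inv_triangular ℝ b (Fin.lt_def.2 (hj.trans_le hi))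

theorem inner_gramSchmidt_proj (b : Fin n → E) {s : ℕ} {i : Fin n} (hi : s ≤ i) (x : E) :
    inner ℝ (gramSchmidt ℝ b i) (proj b s x) = inner ℝ (gramSchmidt ℝ b i) x := by
  rw [proj, ← inner_starProjection_left_eq_right]
  exact congrArg (inner ℝ · x) (proj_gramSchmidt b hi)

theorem proj_mem_span_projBlock (b : Fin n → E) {s k : ℕ} (h : s + k ≤ n) (l : Fin k) {x : E}
    (hx : x ∈ span ℝ (b '' Set.Iio ⟨s + l, by omega⟩)) :
    proj b s x ∈ span ℝ (projBlock b s k h '' Set.Iio l) := by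
  suffices hle : span ℝ (b '' Set.Iio ⟨s + l, by omega⟩) ≤
      (span ℝ (projBlock b s k h '' Set.Iio l)).comap (proj b s).toLinearMap from hle hx
  rw [span_le]
  rintro _ ⟨j, hj, rfl⟩
  have hj : (j : ℕ) < s + l := hj
  change proj b s (b j) ∈ span ℝ (projBlock b s k h '' Set.Iio l)
  rcases lt_or_ge (j : ℕ) s with hjs | hjs
  · rw [proj_apply_eq_zero b hjs]
    exact zero_mem _
  · refine subset_span ⟨⟨j - s, by omega⟩, Fin.lt_def.2 (by simp only; omega), ?_⟩
    simp only [projBlock, Nat.add_sub_cancel' hjs]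

theorem gramSchmidt_projBlock (b : Fin n → E) {s k : ℕ} (h : s + k ≤ n) (l : Fin k) :
    gramSchmidt ℝ (projBlock b s k h) l = gramSchmidt ℝ b ⟨s + l, by omega⟩ := by
  have hs : s ≤ ((⟨s + l, by omega⟩ : Fin n) : ℕ) := Nat.le_add_right s l
  refine gramSchmidt_eq_of_mem_orthogonal ?_ (mem_orthogonal_span_image_iff.2 fun j hj => ?_)
  · rw [← proj_gramSchmidt b hs, projBlock, ← map_sub]
    exact proj_mem_span_projBlock b h l (sub_gramSchmidt_mem_span_Iio b _)
  · rw [projBlock, inner_gramSchmidt_proj b hs]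
    exact gramSchmidt_inv_triangular ℝ b (Fin.lt_def.2 (Nat.add_lt_add_left hj s))

theorem linearIndependent_projBlock {b : Fin n → E} (hb : LinearIndependent ℝ b) {s k : ℕ}
    (h : s + k ≤ n) : LinearIndependent ℝ (projBlock b s k h) :=
  linearIndependent_of_gramSchmidt_ne_zero fun l => by
    rw [gramSchmidt_projBlock]
    exact gramSchmidt_ne_zero _ hb

theorem gsLog_projBlock (b : Fin n → E) {s k : ℕ} (h : s + k ≤ n) {l : ℕ} (hl : l < k) :
    gsLog (projBlock b s k h) l = gsLog b (s + l) := by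
  rw [gsLog, dif_pos hl, gramSchmidt_projBlock, gsLog, dif_pos (by omega)]

theorem projBlock_zero (b : Fin n → E) {m : ℕ} (h : 0 + m ≤ n) :
    projBlock b 0 m h = b ∘ Fin.castLE (by omega) := by
  funext l
  simp [projBlock, proj, starProjection_top, Fin.castLE]

end ProjectedBlocks

section LinearForms

open MeasureTheory

variable {ι : Type*} [Fintype ι]

theorem volume_image_closedBall [DecidableEq ι] (M : Matrix ι ι ℝ) {t : ℝ} (ht : 0 ≤ t) :
    volume (Matrix.toLin' M '' Metric.closedBall 0 t) =
      ENNReal.ofReal (|M.det| * (2 * t) ^ Fintype.card ι) := by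
  rw [Measure.addHaar_image_linearMap, Real.volume_pi_closedBall _ ht, LinearMap.det_toLin',
    ENNReal.ofReal_mul (abs_nonneg _)]

theorem exists_int_ne_zero_mem_of_two_pow_le_volume [Nonempty ι] {s : Set (ι → ℝ)}
    (hneg : ∀ x ∈ s, -x ∈ s) (hconv : Convex ℝ s) (hcomp : IsCompact s)
    (hvol : 2 ^ Fintype.card ι ≤ volume s) :
    ∃ c : ι → ℤ, c ≠ 0 ∧ (fun i => (c i : ℝ)) ∈ s := by
  have hdom : volume (ZSpan.fundamentalDomain (Pi.basisFun ℝ ι)) = 1 := by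
    rw [ZSpan.fundamentalDomain_pi_basisFun, volume_pi, Measure.pi_pi]
    simp
  have : Countable (span ℤ (Set.range (Pi.basisFun ℝ ι))).toAddSubgroup :=
    inferInstanceAs (Countable (span ℤ (Set.range (Pi.basisFun ℝ ι))))
  obtain ⟨x, hx0, hx⟩ := exists_ne_zero_mem_lattice_of_measure_mul_two_pow_le_measure
    (ZSpan.isAddFundamentalDomain' (Pi.basisFun ℝ ι) volume) hneg hconv hcomp
    (by rwa [hdom, one_mul, Module.finrank_fintype_fun_eq_card])
  choose c hc using ((Pi.basisFun ℝ ι).mem_span_iff_repr_mem ℤ (x : ι → ℝ)).1 x.2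
  have hcx : (fun i => (c i : ℝ)) = x := funext fun i => by simpa using hc i
  refine ⟨c, ?_, hcx ▸ hx⟩
  rintro rfl
  exact hx0 (Subtype.ext (hcx.symm.trans (by funext i; simp)))

theorem exists_int_ne_zero_abs_mulVec_le [Nonempty ι] [DecidableEq ι] (M : Matrix ι ι ℝ)
    {t : ℝ} (ht : 0 ≤ t) (hM : M.det ≠ 0) (hMt : |M.det| ≤ t ^ Fintype.card ι) :
    ∃ c : ι → ℤ, c ≠ 0 ∧ ∀ i, |M.mulVec (fun j => (c j : ℝ)) i| ≤ t := by
  obtain ⟨c, hc, y, hy, hyc⟩ := exists_int_ne_zero_mem_of_two_pow_le_volume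
    (s := Matrix.toLin' M⁻¹ '' Metric.closedBall 0 t)
    (by
      rintro _ ⟨y, hy, rfl⟩
      exact ⟨-y, by simpa using hy, map_neg _ _⟩)
    ((convex_closedBall _ _).linear_image _)
    ((isCompact_closedBall _ _).image (LinearMap.continuous_of_finiteDimensional _))
    (by
      rw [volume_image_closedBall _ ht, Matrix.det_nonsing_inv, Ring.inverse_eq_inv', abs_inv,
        ← ENNReal.ofReal_ofNat, ← ENNReal.ofReal_pow zero_le_two, mul_pow]
      refine ENNReal.ofReal_le_ofReal ?_
      rw [le_inv_mul_iff₀ (abs_pos.2 hM), mul_comm]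
      gcongr)
  refine ⟨c, hc, fun i => ?_⟩
  rw [← hyc, Matrix.toLin'_apply, Matrix.mulVec_mulVec,
    Matrix.mul_nonsing_inv _ (isUnit_iff_ne_zero.2 hM), Matrix.one_mulVec]
  exact (norm_le_pi_norm y i).trans (mem_closedBall_zero_iff.1 hy)

end LinearForms

theorem latticeOf_comp_le {E : Type*} [NormedAddCommGroup E] {n m : ℕ} (b : Fin n → E)
    (f : Fin m → Fin n) : latticeOf (b ∘ f) ≤ latticeOf b :=
  span_mono (Set.range_comp_subset_range f b)

section Minkowski

variable {E : Type*} [NormedAddCommGroup E] [InnerProductSpace ℝ E]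

theorem norm_le_sqrt_card_mul {ι : Type*} [Fintype ι] {o : ι → E} (ho : Orthonormal ℝ o)
    {x : E} (hx : x ∈ span ℝ (Set.range o)) {t : ℝ} (hxt : ∀ i, |inner ℝ (o i) x| ≤ t) :
    ‖x‖ ≤ √(Fintype.card ι) * t := by
  obtain ⟨a, rfl⟩ := (mem_span_range_iff_exists_fun ℝ).1 hx
  rcases isEmpty_or_nonempty ι with hι | hι
  · simp
  have ht : 0 ≤ t := (abs_nonneg _).trans (hxt hι.some)
  have hnorm : ‖∑ i, a i • o i‖ ^ 2 = ∑ i, a i ^ 2 := by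
    rw [← real_inner_self_eq_norm_sq, ho.inner_sum]
    simp [sq]
  have ha : ∀ i, a i ^ 2 ≤ t ^ 2 := fun i => by
    rw [← ho.inner_right_fintype a i]
    exact sq_le_sq' (abs_le.1 (hxt i)).1 (abs_le.1 (hxt i)).2
  rw [← Real.sqrt_sq ht, ← Real.sqrt_mul (by positivity)]
  refine Real.le_sqrt_of_sq_le (hnorm.trans_le ?_)
  simpa using Finset.sum_le_card_nsmul Finset.univ _ _ fun i _ => ha i

theorem exists_ne_zero_mem_latticeOf_norm_le {m : ℕ} [NeZero m] {v : Fin m → E}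
    (hv : LinearIndependent ℝ v) :
    ∃ x ∈ latticeOf v, x ≠ 0 ∧ ‖x‖ ≤ √m * (∏ i, ‖gramSchmidt ℝ v i‖) ^ (m⁻¹ : ℝ) := by
  have hpos : 0 < ∏ i, ‖gramSchmidt ℝ v i‖ :=
    Finset.prod_pos fun i _ => norm_pos_iff.2 (gramSchmidt_ne_zero i hv)
  have hdet := det_inner_gramSchmidtNormed v
  set M := Matrix.of fun i j => inner ℝ (gramSchmidtNormed ℝ v i) (v j) with hM
  set t := (∏ i, ‖gramSchmidt ℝ v i‖) ^ (m⁻¹ : ℝ) with ht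
  obtain ⟨c, hc0, hc⟩ := exists_int_ne_zero_abs_mulVec_le M (t := t) (by positivity)
    (hdet ▸ hpos.ne') (by
      rw [hdet, abs_of_pos hpos, Fintype.card_fin, ht,
        Real.rpow_inv_natCast_pow hpos.le (NeZero.ne m)])
  have hinner : ∀ i, inner ℝ (gramSchmidtNormed ℝ v i) (∑ j, c j • v j) =
      M.mulVec (fun j => (c j : ℝ)) i := fun i => by
    simp [hM, Matrix.mulVec, dotProduct, inner_sum, ← Int.cast_smul_eq_zsmul ℝ,
      real_inner_smul_right, mul_comm]
  have hmem : ∑ j, c j • v j ∈ latticeOf v :=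
    sum_mem fun j _ => smul_mem _ _ (subset_span ⟨j, rfl⟩)
  refine ⟨_, hmem, fun h0 => hc0 ?_, ?_⟩
  · simp only [← Int.cast_smul_eq_zsmul ℝ] at h0
    exact funext fun j => Int.cast_eq_zero.1 (Fintype.linearIndependent_iff.1 hv _ h0 j)
  · refine (norm_le_sqrt_card_mul (gramSchmidtNormed_orthonormal hv) (t := t) ?_
      fun i => (hinner i).symm ▸ hc i).trans_eq (by rw [Fintype.card_fin])
    rw [span_gramSchmidtNormed_range, span_gramSchmidt]
    exact span_le_restrictScalars ℤ ℝ _ hmem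

theorem successiveMinimum_nonneg (L : Submodule ℤ E) (i : ℕ) : 0 ≤ successiveMinimum L i :=
  Real.sInf_nonneg fun _ hr => hr.1.le

variable [FiniteDimensional ℝ E]

theorem successiveMinimum_one_le_norm {L : Submodule ℤ E} {x : E} (hx : x ∈ L) (hx0 : x ≠ 0) :
    successiveMinimum L 1 ≤ ‖x‖ := by
  refine csInf_le ⟨0, fun r hr => hr.1.le⟩ ⟨norm_pos_iff.2 hx0, ?_⟩
  rw [one_le_finrank_iff]
  exact ne_bot_of_le_ne_bot (mt span_singleton_eq_bot.1 hx0)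
    (span_mono (Set.singleton_subset_iff.2 ⟨hx, by simp⟩))

theorem successiveMinimum_one_le_exp {n m : ℕ} {b : Fin n → E} (hb : LinearIndependent ℝ b)
    {L : Submodule ℤ E} (hL : latticeOf b ≤ L) (hm : 0 < m) (hmn : m ≤ n) :
    successiveMinimum L 1 ≤ Real.exp (Real.log m / 2 + (∑ l ∈ Finset.range m, gsLog b l) / m) := by
  have : NeZero m := ⟨hm.ne'⟩
  have hmn' : 0 + m ≤ n := by omega
  obtain ⟨x, hx, hx0, hxle⟩ :=
    exists_ne_zero_mem_latticeOf_norm_le (linearIndependent_projBlock hb hmn')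
  refine (successiveMinimum_one_le_norm (hL ?_) hx0).trans (hxle.trans_eq ?_)
  · rw [projBlock_zero] at hx
    exact latticeOf_comp_le b _ hx
  · have hsum : ∑ l ∈ Finset.range m, gsLog b l =
        Real.log (∏ i, ‖gramSchmidt ℝ (projBlock b 0 m hmn') i‖) := by
      rw [← sum_range_gsLog (linearIndependent_projBlock hb hmn')]
      refine Finset.sum_congr rfl fun l hl => ?_
      rw [gsLog_projBlock b hmn' (Finset.mem_range.1 hl), zero_add]
    have hpos : 0 < ∏ i, ‖gramSchmidt ℝ (projBlock b 0 m hmn') i‖ :=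
      Finset.prod_pos fun i _ => norm_pos_iff.2
        (gramSchmidt_ne_zero i (linearIndependent_projBlock hb hmn'))
    rw [Real.exp_add, hsum, Real.exp_half, Real.exp_log (by exact_mod_cast hm),
      div_eq_mul_inv, ← Real.rpow_def_of_pos hpos]

theorem mul_gsLog_zero_le {n m : ℕ} {b : Fin (n + 1) → E} (hb : LinearIndependent ℝ b)
    {L : Submodule ℤ E} (hL : latticeOf b ≤ L) {K : ℝ}
    (hK : ‖b 0‖ ≤ K * successiveMinimum L 1) (hmn : m ≤ n + 1) :
    m * gsLog b 0 ≤ m * (Real.log K + Real.log m / 2) + ∑ l ∈ Finset.range m, gsLog b l := by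
  rcases m.eq_zero_or_pos with rfl | hm
  · simp
  have hpos : 0 < ‖b 0‖ := norm_pos_iff.2 (hb.ne_zero 0)
  have hKpos : 0 < K :=
    pos_of_mul_pos_left (hpos.trans_le hK) (successiveMinimum_nonneg L 1)
  have hm' : (0 : ℝ) < m := Nat.cast_pos.2 hm
  have h := hK.trans
    (mul_le_mul_of_nonneg_left (successiveMinimum_one_le_exp hb hL hm hmn) hKpos.le)
  have hlog : gsLog b 0 ≤ Real.log K + Real.log m / 2 + (∑ l ∈ Finset.range m, gsLog b l) / m := by
    rw [gsLog_zero, add_assoc, ← Real.log_exp (Real.log m / 2 + _), ← Real.log_mul hKpos.ne']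
    · exact Real.log_le_log hpos h
    · positivity
  calc m * gsLog b 0
      ≤ m * (Real.log K + Real.log m / 2 + (∑ l ∈ Finset.range m, gsLog b l) / m) := by gcongr
    _ = _ := by rw [mul_add, mul_div_cancel₀ _ hm'.ne']

end Minkowski

section DualBasis

variable {E : Type*} [NormedAddCommGroup E] [InnerProductSpace ℝ E]

theorem linearIndependent_of_biorthogonal {ι : Type*} {b d : ι → E}
    (h : Pairwise fun i j => inner ℝ (d i) (b j) = 0) (h' : ∀ i, inner ℝ (d i) (b i) = 1) :
    LinearIndependent ℝ b :=
  LinearIndependent.of_pairwise_dual_eq_zero_one b (fun i => innerₛₗ ℝ (d i)) h h'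

namespace IsDualBasis

variable {n : ℕ} {b d : Fin n → E}

theorem inner_self (h : IsDualBasis b d) (i : Fin n) : inner ℝ (d i) (b i) = 1 :=
  (h.2 i i).trans (if_pos rfl)

theorem inner_of_ne (h : IsDualBasis b d) {i j : Fin n} (hij : i ≠ j) :
    inner ℝ (d i) (b j) = 0 :=
  (h.2 i j).trans (if_neg hij)

theorem linearIndependent_left (h : IsDualBasis b d) : LinearIndependent ℝ b :=
  linearIndependent_of_biorthogonal (fun _ _ => h.inner_of_ne) h.inner_self

theorem linearIndependent_right (h : IsDualBasis b d) : LinearIndependent ℝ d :=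
  linearIndependent_of_biorthogonal (d := b)
    (fun _ _ hij => (real_inner_comm _ _).trans (h.inner_of_ne hij.symm))
    fun i => (real_inner_comm _ _).trans (h.inner_self i)

theorem inner_left_eq_zero_of_mem_span (h : IsDualBasis b d) {s : Set (Fin n)} {i : Fin n}
    (hi : i ∉ s) {x : E} (hx : x ∈ span ℝ (b '' s)) : inner ℝ (d i) x = 0 :=
  inner_left_of_mem_orthogonal hx <| mem_orthogonal_span_image_iff.2 fun _ hj =>
    h.inner_of_ne fun hij => hi (hij ▸ hj)

theorem span_right (h : IsDualBasis b d) : span ℝ (Set.range d) = span ℝ (Set.range b) := by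
  have := FiniteDimensional.span_of_finite ℝ (Set.finite_range b)
  refine eq_of_le_of_finrank_eq (span_le.2 (Set.range_subset_iff.2 h.1)) ?_
  rw [finrank_span_eq_card h.linearIndependent_left, finrank_span_eq_card h.linearIndependent_right]

theorem eq_sum_inner_smul (h : IsDualBasis b d) {x : E} (hx : x ∈ span ℝ (Set.range b)) :
    x = ∑ j, inner ℝ (b j) x • d j := by
  rw [← h.span_right] at hx
  obtain ⟨c, rfl⟩ := (mem_span_range_iff_exists_fun ℝ).1 hx
  refine Finset.sum_congr rfl fun j _ => ?_
  rw [inner_sum, Finset.sum_eq_single j]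
  · rw [real_inner_smul_right, real_inner_comm, h.inner_self, mul_one]
  · intro i _ hij
    rw [real_inner_smul_right, real_inner_comm, h.inner_of_ne hij, mul_zero]
  · simp

theorem mem_span_image_right (h : IsDualBasis b d) {s : Set (Fin n)} {x : E}
    (hx : x ∈ span ℝ (Set.range b)) (hxs : ∀ j ∉ s, inner ℝ (b j) x = 0) :
    x ∈ span ℝ (d '' s) := by
  rw [h.eq_sum_inner_smul hx]
  refine sum_mem fun j _ => ?_
  by_cases hj : j ∈ s
  · exact smul_mem _ _ (subset_span ⟨j, hj, rfl⟩)
  · rw [hxs j hj, zero_smul]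
    exact zero_mem _

theorem gramSchmidt_comp_rev (h : IsDualBasis b d) (i : Fin n) :
    gramSchmidt ℝ (d ∘ Fin.rev) i =
      (‖gramSchmidt ℝ b i.rev‖ ^ 2)⁻¹ • gramSchmidt ℝ b i.rev := by
  have hIio : d ∘ Fin.rev '' Set.Iio i = d '' Set.Ioi i.rev := by
    rw [Set.image_comp, Set.image_eq_preimage_of_inverse Fin.rev_rev Fin.rev_rev,
      Fin.preimage_rev_Iio]
  generalize hp : i.rev = p at hIio
  have hbp : ‖gramSchmidt ℝ b p‖ ^ 2 ≠ 0 :=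
    pow_ne_zero 2 (norm_ne_zero_iff.2 (gramSchmidt_ne_zero p h.linearIndependent_left))
  have hmem : gramSchmidt ℝ b p ∈ span ℝ (b '' Set.Iic p) := by
    rw [← span_gramSchmidt_Iic ℝ b]
    exact subset_span ⟨p, Set.mem_Iic.2 le_rfl, rfl⟩
  apply gramSchmidt_eq_of_mem_orthogonal <;> rw [hIio]
  · rw [Function.comp_apply, hp]
    refine h.mem_span_image_right (sub_mem (h.1 p) (smul_mem _ _ ?_)) fun j (hj : ¬p < j) => ?_
    · exact span_mono (Set.image_subset_range _ _) hmem
    rw [inner_sub_right, real_inner_smul_right, real_inner_comm, real_inner_comm _ (b j)]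
    rcases (not_lt.1 hj).eq_or_lt with rfl | hjp
    · rw [h.inner_self, inner_gramSchmidt_self, inv_mul_cancel₀ hbp, sub_self]
    · rw [h.inner_of_ne hjp.ne', gramSchmidt_inv_triangular ℝ b hjp, mul_zero, sub_self]
  · refine smul_mem _ _ (mem_orthogonal_span_image_iff.2 fun j (hj : p < j) => ?_)
    rw [real_inner_comm, h.inner_left_eq_zero_of_mem_span (Set.notMem_Iic.2 hj) hmem]

theorem norm_gramSchmidt_comp_rev (h : IsDualBasis b d) (i : Fin n) :
    ‖gramSchmidt ℝ (d ∘ Fin.rev) i‖ = ‖gramSchmidt ℝ b i.rev‖⁻¹ := by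
  rw [h.gramSchmidt_comp_rev, norm_smul, norm_inv, norm_pow, norm_norm, sq, mul_inv,
    inv_mul_cancel_right₀ (norm_ne_zero_iff.2 (gramSchmidt_ne_zero _ h.linearIndependent_left))]

theorem gsLog_comp_rev (h : IsDualBasis b d) {l : ℕ} (hl : l < n) :
    gsLog (d ∘ Fin.rev) l = -gsLog b (n - 1 - l) := by
  have hrev : ((⟨l, hl⟩ : Fin n).rev : ℕ) = n - 1 - l := by
    simp only [Fin.val_rev]
    omega
  rw [← hrev, gsLog_coe, gsLog, dif_pos hl, h.norm_gramSchmidt_comp_rev, Real.log_inv]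

theorem latticeOf_comp_rev_le (h : IsDualBasis b d) :
    latticeOf (d ∘ Fin.rev) ≤ dualLattice (latticeOf b) := by
  refine (latticeOf_comp_le d Fin.rev).trans (span_le.2 (Set.range_subset_iff.2 fun i => ?_))
  refine ⟨span_mono subset_span (h.1 i), fun y hy => ?_⟩
  obtain ⟨c, rfl⟩ := (mem_span_range_iff_exists_fun ℤ).1 hy
  refine ⟨c i, ?_⟩
  simp [inner_sum, ← Int.cast_smul_eq_zsmul ℝ, real_inner_smul_right, h.2]

end IsDualBasis

end DualBasis

section Profiles

/-- The logarithmic form, with constants from Minkowski's theorem, of the inequalities satisfied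
by the Gram–Schmidt lengths `exp (X 0), …, exp (X (k - 1))` of an HKZ-reduced basis: each `X a` is
at most the mean of any stretch `X a, …, X (a + m - 1)` plus `log m / 2`. -/
def IsHKZProfile (X : ℕ → ℝ) (k : ℕ) : Prop :=
  ∀ a m : ℕ, a + m ≤ k →
    m * X a ≤ m * (Real.log m / 2) + ∑ l ∈ Finset.range m, X (a + l)

/-- The counterpart of `IsHKZProfile` for an `ε`-DSVP-reduced basis, where `δ = log (1 + ε)`: the
mean of the last `m` entries of `X 0, …, X (k - 1)` exceeds `X (k - 1)` by at most
`δ + log m / 2`. -/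
def IsDSVPProfile (δ : ℝ) (X : ℕ → ℝ) (k : ℕ) : Prop :=
  ∀ m ≤ k, ∑ l ∈ Finset.range m, X (k - 1 - l) ≤ m * (δ + Real.log m / 2 + X (k - 1))

/-- The block structure of the logarithmic profile of a slide-reduced basis with `N` blocks of
length `k`: HKZ profiles on the blocks, DSVP profiles on the blocks shifted by one. -/
structure IsSlideProfile (δ : ℝ) (X : ℕ → ℝ) (k N : ℕ) : Prop where
  hkz : ∀ p < N, IsHKZProfile (fun l => X (p * k + l)) k
  dsvp : ∀ p, p + 1 < N → IsDSVPProfile δ (fun l => X (p * k + 1 + l)) k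

theorem IsHKZProfile.congr {X Y : ℕ → ℝ} {k : ℕ} (h : IsHKZProfile X k)
    (hXY : ∀ l < k, X l = Y l) : IsHKZProfile Y k := by
  intro a m ham
  rcases m.eq_zero_or_pos with rfl | hm
  · simp
  rw [← hXY a (by omega), ← Finset.sum_congr rfl fun l hl =>
    hXY (a + l) (by have := Finset.mem_range.1 hl; omega)]
  exact h a m ham

theorem IsHKZProfile.of_tail {X : ℕ → ℝ} {k : ℕ}
    (hhead : ∀ m ≤ k + 1, m * X 0 ≤ m * (Real.log m / 2) + ∑ l ∈ Finset.range m, X l)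
    (htail : IsHKZProfile (fun l => X (l + 1)) k) : IsHKZProfile X (k + 1) := by
  rintro (_ | a) m ham
  · simpa using hhead m (by omega)
  · simpa [add_right_comm] using htail a m (by omega)

theorem IsDSVPProfile.congr {δ : ℝ} {X Y : ℕ → ℝ} {k : ℕ} (h : IsDSVPProfile δ X k)
    (hXY : ∀ l < k, X l = Y l) : IsDSVPProfile δ Y k := by
  intro m hmk
  rcases m.eq_zero_or_pos with rfl | hm
  · simp
  rw [← hXY (k - 1) (by omega), ← Finset.sum_congr rfl fun l _ => hXY (k - 1 - l) (by omega)]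
  exact h m hmk

variable {E : Type*} [NormedAddCommGroup E] [InnerProductSpace ℝ E]

theorem IsDSVPReduced.mono {ε ε' : ℝ} {n : ℕ} {b : Fin n → E} (h : IsDSVPReduced ε b)
    (hε : ε ≤ ε') : IsDSVPReduced ε' b := by
  obtain ⟨d, hd, hlast⟩ := h
  refine ⟨d, hd, fun i hi => (hlast i hi).trans ?_⟩
  have := successiveMinimum_nonneg (dualLattice (latticeOf b)) 1
  gcongr

variable [FiniteDimensional ℝ E]

theorem IsSlideReduced.mono {ε ε' : ℝ} {n k : ℕ} {b : Fin n → E} (h : IsSlideReduced ε k b)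
    (hε : ε ≤ ε') : IsSlideReduced ε' k b :=
  ⟨h.sizeReduced, h.hkz, fun i hi => (h.dsvp i hi).mono hε⟩

theorem IsHKZReduced.tail {n : ℕ} {b : Fin (n + 1) → E} (h : IsHKZReduced b) :
    IsHKZReduced (projBlock b 1 n (Nat.add_comm 1 n).le) := by
  have hproj : projBlock b 1 n (Nat.add_comm 1 n).le = fun i => proj b 1 (b i.succ) :=
    funext fun i => congrArg (fun j => proj b 1 (b j)) (Fin.ext (Nat.add_comm 1 i))
  exact hproj ▸ h.2.2

theorem IsHKZReduced.isHKZProfile {n : ℕ} {b : Fin n → E} (h : IsHKZReduced b)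
    (hb : LinearIndependent ℝ b) : IsHKZProfile (gsLog b) n := by
  induction n with
  | zero =>
    intro a m ham
    obtain rfl : m = 0 := by omega
    simp
  | succ n ih =>
    have hn : 1 + n ≤ n + 1 := (Nat.add_comm 1 n).le
    have htail : IsHKZProfile (gsLog (projBlock b 1 n hn)) n :=
      ih h.tail (linearIndependent_projBlock hb hn)
    have hhead : ‖b 0‖ ≤ 1 * successiveMinimum (latticeOf b) 1 := by rw [one_mul, h.2.1]
    refine .of_tail (fun m hm => ?_) (htail.congr fun l hl => ?_)
    · simpa using mul_gsLog_zero_le hb le_rfl hhead hm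
    · rw [gsLog_projBlock b hn hl, add_comm 1 l]

theorem IsDSVPReduced.isDSVPProfile {ε : ℝ} {n : ℕ} {b : Fin n → E} (h : IsDSVPReduced ε b) :
    IsDSVPProfile (Real.log (1 + ε)) (gsLog b) n := by
  obtain ⟨d, hd, hlast⟩ := h
  intro m hmn
  cases n with
  | zero =>
    obtain rfl : m = 0 := by omega
    simp
  | succ n =>
    have hlast' : ‖(d ∘ Fin.rev) 0‖ ≤ (1 + ε) * successiveMinimum (dualLattice (latticeOf b)) 1 :=
      hlast _ (by simp)
    have hli : LinearIndependent ℝ (d ∘ Fin.rev) :=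
      hd.linearIndependent_right.comp _ Fin.rev_injective
    have hminkowski := mul_gsLog_zero_le hli hd.latticeOf_comp_rev_le hlast' hmn
    rw [hd.gsLog_comp_rev n.succ_pos, Finset.sum_congr rfl fun l hl => hd.gsLog_comp_rev
      ((Finset.mem_range.1 hl).trans_le hmn), Finset.sum_neg_distrib, Nat.sub_zero] at hminkowski
    linarith

theorem IsSlideReduced.isSlideProfile {ε : ℝ} {k N : ℕ} {b : Fin (k * N) → E}
    (h : IsSlideReduced ε k b) (hb : LinearIndependent ℝ b) (hk : 0 < k) :
    IsSlideProfile (Real.log (1 + ε)) (gsLog b) k N where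
  hkz p hp := by
    have hle : p * k + k ≤ k * N := by nlinarith
    exact ((h.hkz p hle).isHKZProfile (linearIndependent_projBlock hb hle)).congr fun l hl =>
      gsLog_projBlock b hle hl
  dsvp p hp := by
    have hle : p * k + 1 + k ≤ k * N := by nlinarith
    exact (h.dsvp p hle).isDSVPProfile.congr fun l hl => gsLog_projBlock b hle hl

end Profiles

section SequenceEstimates

theorem sum_range_harmonic (m : ℕ) :
    ∑ l ∈ Finset.range m, harmonic l = m * harmonic m - m := by
  induction m with
  | zero => simp
  | succ m ih =>
    rw [Finset.sum_range_succ, ih, harmonic_succ]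
    push_cast
    field_simp
    ring

theorem le_add_mul_harmonic {y : ℕ → ℝ} {N : ℕ} {c : ℝ}
    (h : ∀ m, 0 < m → m ≤ N → m * y m ≤ m * c + ∑ l ∈ Finset.range m, y l)
    {m : ℕ} (hm : m ≤ N) : y m ≤ y 0 + c * harmonic m := by
  induction m using Nat.strong_induction_on with
  | _ m ih =>
    rcases m.eq_zero_or_pos with rfl | hpos
    · simp
    have hm0 : (0 : ℝ) < m := Nat.cast_pos.2 hpos
    have hharm : ∑ l ∈ Finset.range m, (harmonic l : ℝ) = m * harmonic m - m := by
      exact_mod_cast sum_range_harmonic m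
    refine le_of_mul_le_mul_left ?_ hm0
    calc m * y m ≤ m * c + ∑ l ∈ Finset.range m, y l := h m hpos hm
      _ ≤ m * c + ∑ l ∈ Finset.range m, (y 0 + c * harmonic l) := by
        gcongr with l hl
        exact ih l (Finset.mem_range.1 hl) ((Finset.mem_range.1 hl).le.trans hm)
      _ = m * (y 0 + c * harmonic m) := by
        rw [Finset.sum_add_distrib, ← Finset.mul_sum, hharm, Finset.sum_const, Finset.card_range,
          nsmul_eq_mul]
        ring

theorem log_natCast_le_log_natCast {m k : ℕ} (hmk : m ≤ k) : Real.log m ≤ Real.log k := by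
  rcases m.eq_zero_or_pos with rfl | hm
  · simpa using Real.log_natCast_nonneg k
  · exact Real.log_le_log (Nat.cast_pos.2 hm) (Nat.cast_le.2 hmk)

variable {X : ℕ → ℝ} {k : ℕ}

theorem IsHKZProfile.sub_le (h : IsHKZProfile X k) {a e : ℕ} (hae : a ≤ e) (hek : e < k) :
    X a - X e ≤ Real.log k * (1 + Real.log k) := by
  have hc : 0 ≤ Real.log k := Real.log_natCast_nonneg k
  have hrec : ∀ m, 0 < m → m ≤ e →
      m * X (e - m) ≤ m * Real.log k + ∑ l ∈ Finset.range m, X (e - l) := by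
    intro m hm hme
    have hsum : ∑ l ∈ Finset.range m, X (e - m + (l + 1)) = ∑ l ∈ Finset.range m, X (e - l) := by
      rw [← Finset.sum_range_reflect]
      refine Finset.sum_congr rfl fun l hl => ?_
      rw [Finset.mem_range] at hl
      congr 1
      omega
    have hmean := h (e - m) (m + 1) (by omega)
    rw [Finset.sum_range_succ', hsum] at hmean
    have hlog := log_natCast_le_log_natCast (m := m + 1) (k := k) (by omega)
    have hm1 : (1 : ℝ) ≤ m := Nat.one_le_cast.2 hm
    push_cast at hmean hlog
    rw [add_zero] at hmean
    have hcoeff : ((m : ℝ) + 1) * (Real.log (m + 1) / 2) ≤ m * Real.log k := by nlinarith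
    linarith
  have hgronwall := le_add_mul_harmonic (y := fun m => X (e - m)) hrec (Nat.sub_le e a)
  have hharm : (harmonic (e - a) : ℝ) ≤ 1 + Real.log k :=
    (harmonic_le_one_add_log _).trans
      (add_le_add le_rfl (log_natCast_le_log_natCast (by omega)))
  simp only [Nat.sub_sub_self hae, Nat.sub_zero] at hgronwall
  linarith [mul_le_mul_of_nonneg_left hharm hc]

namespace IsSlideProfile

variable {N : ℕ} {δ : ℝ}

theorem first_sub_first_le (h : IsSlideProfile δ X k N) (hk : 2 ≤ k) (hδ : δ ≤ Real.log k) {p : ℕ}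
    (hp : p + 1 < N) : X (p * k) - X ((p + 1) * k) ≤ 4 * Real.log k := by
  have hhkz := h.hkz p (by omega) 0 k (by omega)
  have hdsvp := h.dsvp p hp k le_rfl
  obtain ⟨r, rfl⟩ : ∃ r, k = r + 1 := ⟨k - 1, by omega⟩
  have hc := Real.log_natCast_nonneg (r + 1)
  have hr : (1 : ℝ) ≤ r := Nat.one_le_cast.2 (by omega)
  set S := ∑ l ∈ Finset.range r, X (p * (r + 1) + 1 + l) with hS
  set c := Real.log (r + 1 : ℕ)
  have hlast : p * (r + 1) + 1 + r = (p + 1) * (r + 1) := by ring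
  have hhkzSum : ∑ l ∈ Finset.range r, X (p * (r + 1) + (0 + (l + 1))) = S :=
    Finset.sum_congr rfl fun l _ => congrArg X (by omega)
  have hdsvpSum : ∑ l ∈ Finset.range r, X (p * (r + 1) + 1 + (r - (l + 1))) = S := by
    rw [hS, ← Finset.sum_range_reflect (fun l => X (p * (r + 1) + 1 + l))]
    exact Finset.sum_congr rfl fun l _ => congrArg X (by omega)
  rw [Finset.sum_range_succ'] at hhkz hdsvp
  simp only [hhkzSum, add_zero] at hhkz
  simp only [Nat.add_sub_cancel, Nat.sub_zero, hlast, hdsvpSum] at hdsvp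
  push_cast at hhkz hdsvp
  refine le_of_mul_le_mul_left ?_ (one_pos.trans_le hr)
  nlinarith

theorem last_sub_first_le (h : IsSlideProfile δ X k N) (hk : 2 ≤ k) (hδ : δ ≤ Real.log k) {p : ℕ}
    (hp : p + 1 < N) : X (p * k + (k - 1)) - X ((p + 1) * k) ≤ 3 * Real.log k := by
  have hdsvp := h.dsvp p hp 2 hk
  have hlast : p * k + 1 + (k - 1) = (p + 1) * k := by rw [add_one_mul]; omega
  have hprev : p * k + 1 + (k - 1 - 1) = p * k + (k - 1) := by omega
  have hlog := log_natCast_le_log_natCast hk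
  simp only [Finset.sum_range_succ, Finset.sum_range_zero, Nat.sub_zero, zero_add, hlast, hprev,
    Nat.cast_ofNat] at hdsvp hlog
  linarith

theorem sub_first_le (h : IsSlideProfile δ X k N) (hk : 2 ≤ k) (hδ : δ ≤ Real.log k) {p r : ℕ}
    (hp : p + 1 < N) (hr : r < k) :
    X (p * k + r) - X ((p + 1) * k) ≤ Real.log k * (4 + Real.log k) := by
  have hblock := (h.hkz p (by omega)).sub_le (Nat.le_sub_one_of_lt hr) (Nat.sub_one_lt_of_lt hr)
  linarith [h.last_sub_first_le hk hδ hp]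

theorem first_sub_first_add_le (h : IsSlideProfile δ X k N) (hk : 2 ≤ k) (hδ : δ ≤ Real.log k)
    {p t : ℕ} (hpt : p + t < N) : X (p * k) - X ((p + t) * k) ≤ t * (4 * Real.log k) := by
  induction t with
  | zero => simp
  | succ t ih =>
    have hstep := h.first_sub_first_le hk hδ (p := p + t) (by omega)
    rw [← add_assoc p t 1]
    push_cast
    linarith [ih (by omega)]

theorem sub_le (h : IsSlideProfile δ X k N) (hk : 2 ≤ k) (hδ : δ ≤ Real.log k) {i j : ℕ}
    (hij : i ≤ j) (hj : j < N * k) : X i - X j ≤ 4 * (Real.log k * (N + Real.log k)) := by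
  have hc : 0 ≤ Real.log k := Real.log_natCast_nonneg k
  obtain ⟨p, r, hr, rfl⟩ : ∃ p r, r < k ∧ p * k + r = i :=
    ⟨i / k, i % k, Nat.mod_lt i (by omega), Nat.div_add_mod' i k⟩
  obtain ⟨q, s, hs, rfl⟩ : ∃ q s, s < k ∧ q * k + s = j :=
    ⟨j / k, j % k, Nat.mod_lt j (by omega), Nat.div_add_mod' j k⟩
  have hq : q < N := lt_of_mul_lt_mul_right (by omega : q * k < N * k) k.zero_le
  have hpq : p ≤ q := Nat.le_of_lt_succ <|
    lt_of_mul_lt_mul_right (by rw [add_one_mul]; omega : p * k < (q + 1) * k) k.zero_le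
  rcases hpq.eq_or_lt with rfl | hlt
  · have hblock := (h.hkz p hq).sub_le (by omega : r ≤ s) hs
    have hN : (1 : ℝ) ≤ N := Nat.one_le_cast.2 (by omega)
    nlinarith
  · obtain ⟨t, rfl⟩ := Nat.exists_eq_add_of_lt hlt
    rw [add_right_comm p t 1] at hq hij hj ⊢
    have hhead := h.sub_first_le hk hδ (p := p) (by omega) hr
    have hchain := h.first_sub_first_add_le hk hδ hq
    have htail := (h.hkz _ hq).sub_le s.zero_le hs
    have htN : (t : ℝ) + 2 ≤ N := by exact_mod_cast (by omega : t + 2 ≤ N)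
    simp only [add_zero] at htail
    nlinarith

end IsSlideProfile

end SequenceEstimates

end LatticeReduction

theorem proposition2p10_general {E : Type*} [NormedAddCommGroup E] [InnerProductSpace ℝ E]
    [FiniteDimensional ℝ E] {n k : ℕ} (hn : 0 < n) (hk : 2 ≤ k) (hkn : k ∣ n) {ε : ℝ}
    (hε : ε ≤ k - 1) {b : Fin n → E} (hb : LinearIndependent ℝ b)
    (h : LatticeReduction.IsSlideReduced ε k b) :
    LatticeReduction.gsDecay b ≤ (k : ℝ) ^ (4 * ((n : ℝ) / k + Real.log k)) := by
  obtain ⟨N, rfl⟩ := hkn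
  have hk0 : (0 : ℝ) < k := Nat.cast_pos.2 (by omega)
  have hprofile := (h.mono hε).isSlideProfile hb (by omega)
  rw [add_sub_cancel] at hprofile
  have : Nonempty {p : Fin (k * N) × Fin (k * N) // p.1 ≤ p.2} := ⟨⟨(⟨0, hn⟩, ⟨0, hn⟩), le_rfl⟩⟩
  refine ciSup_le fun ⟨⟨i, j⟩, (hij : i ≤ j)⟩ => ?_
  have hpos : ∀ i, 0 < ‖InnerProductSpace.gramSchmidt ℝ b i‖ := fun i =>
    norm_pos_iff.2 (InnerProductSpace.gramSchmidt_ne_zero i hb)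
  have hlog := hprofile.sub_le hk le_rfl hij (j.2.trans_eq (mul_comm k N))
  rw [LatticeReduction.gsLog_coe, LatticeReduction.gsLog_coe,
    ← Real.log_div (hpos i).ne' (hpos j).ne'] at hlog
  rw [Real.rpow_def_of_pos hk0, ← Real.log_le_iff_le_exp (div_pos (hpos i) (hpos j)),
    Nat.cast_mul, mul_div_cancel_left₀ _ hk0.ne', mul_left_comm]
  exact hlog

theorem proposition2p10 :
    ∃ C : ℝ, 0 < C ∧
      ∀ (n k : ℕ), 0 < n → 2 ≤ k → k ∣ n →
      ∀ (L : Submodule ℤ (EuclideanSpace ℝ (Fin n))),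
        (∀ x ∈ L, ∀ i, ∃ q : ℚ, x i = (q : ℝ)) →
      ∀ (b : Fin n → EuclideanSpace ℝ (Fin n)),
        LatticeReduction.IsLatticeBasis b L →
        LatticeReduction.IsSlideReduced (1 / (n : ℝ)) k b →
        LatticeReduction.gsDecay b ≤ (k : ℝ) ^ (C * ((n : ℝ) / (k : ℝ) + Real.log (k : ℝ))) := by
  refine ⟨4, four_pos, fun n k hn hk hkn L _ b hbL h =>
    proposition2p10_general hn hk hkn ?_ hbL.1 h⟩
  have hn1 : 1 / (n : ℝ) ≤ 1 := div_le_one_of_le₀ (Nat.one_le_cast.2 hn) n.cast_nonneg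
  linarith [(Nat.ofNat_le_cast (α := ℝ)).2 hk]
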